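/- **Theorem (stability of $(f,g)$-forward–backward persistence).** Let $X$ be a nonempty finite cell complex, i.e. a Hausdorff space with a CW structure with finitely many cells; this includes finite graphs (self-loops and multiple edges allowed), finite simplicial complexes and finite regular cell complexes. For cells $\tau,\sigma$ write $\tau\le\sigma$ if the closed cell $\sigma$ meets the open cell $\tau$. A *filtration function* on $X$ is a function $f$ from the set of cells to $\mathbb{R}$ with $f(\tau)\le f(\sigma)$ whenever $\tau\le\sigma$; then $X^f_{\le t}$, the union of all cells $\sigma$ with $f(\sigma)\le t$, is a subcomplex for every $t$. Let $f,g$ be positive filtration functions on $X$, with values $a_0<\dots<a_n$ and $b_0<\dots<b_m$ respectively. The $(f,g)$-forward–backward sequence is $$X^f_{\le a_0}\hookrightarrow X^f_{\le a_1}\hookrightarrow\cdots\hookrightarrow X^f_{\le a_n}=X\to X/X^g_{\le b_0}\to X/X^g_{\le b_1}\to\cdots\to X/X^g_{\le b_m}=*,$$ with inclusions followed by the natural quotient maps. Its steps have *function times* $a_0<\dots<a_n<\max f+b_0<\dots<\max f+b_m$. The diagram $\operatorname{PH}^{FB}_i(X,f,g)$ is the multiset of (birth, death) pairs of an interval decomposition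 of the sequence of vector spaces obtained by applying $H_i(-;\mathbb{Z}/2)$, where the birth step and the death step are replaced by their function times, and the death time is $\infty$ for classes that never die. The bottleneck distance $d_B(D,D')$ is the infimum of all $\delta\ge 0$ for which there is a bijection between a part of $D$ and a part of $D'$ such that matched points are at distance at most $\delta$ in the sup norm (with $|\infty-\infty|=0$) and every unmatched point $(b,d)$ of $D$ or $D'$ satisfies $(d-b)/2\le\delta$, i.e. is matched with the diagonal. Then for any two pairs $(f,g)$, $(f',g')$ of positive filtration functions on $X$ and every $i\ge 0$, the diagrams exist and $$d_B\bigl(\operatorname{PH}^{FB}_i(X,f,g),\operatorname{PH}^{FB}_i(X,f',g')\bigr)\le 2\|f-f'\|_\infty+\|g-g'\|_\infty+|\max f-\max f'|.$$ -/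

import Mathlib

open CategoryTheory Topology

universe u v

noncomputable section

namespace FBPersistence

/-! ### Cells, filtration functions, sublevel complexes -/

section Complex

variable {X : Type u} [TopologicalSpace X]

/-- The cells (of all dimensions) of a CW complex `C`. -/
abbrev Cells (C : Set X) [CWComplex C] : Type u := Σ n : ℕ, RelCWComplex.cell C n

variable {C : Set X} [CWComplex C]

/-- The open cell `σ`, as a subset of the ambient space. -/
def openCell (σ : Cells C) : Set X := RelCWComplex.openCell σ.1 σ.2

/-- The closed cell `σ`, as a subset of the ambient space. -/
def closedCell (σ : Cells C) : Set X := RelCWComplex.closedCell σ.1 σ.2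

/-- `τ ≤ σ`: part of the cell `σ` is attached onto `τ`, that is, the closed cell `σ` meets the
open cell `τ`. In a regular complex this says that `τ` lies in the closure of `σ`. -/
def IsFace (τ σ : Cells C) : Prop := (openCell τ ∩ closedCell σ).Nonempty

/-- `f` is a filtration function: it is monotone along the face relation. -/
def IsFiltration (f : Cells C → ℝ) : Prop := ∀ τ σ : Cells C, IsFace τ σ → f τ ≤ f σ

/-- The union of all the cells on which `f` is at most `t`; for a filtration function it is a
subcomplex. -/
def sublevel (f : Cells C → ℝ) (t : ℝ) : Set X := ⋃ (σ : Cells C) (_ : f σ ≤ t), openCell σ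

theorem sublevel_mono (f : Cells C → ℝ) {s t : ℝ} (h : s ≤ t) : sublevel f s ⊆ sublevel f t := by
  intro x hx
  simp only [sublevel, Set.mem_iUnion] at hx ⊢
  obtain ⟨σ, hσ, hx⟩ := hx
  exact ⟨σ, hσ.trans h, hx⟩

/-- The maximum of a function on the (finite, nonempty) set of cells. -/
def maxVal (f : Cells C → ℝ) : ℝ := ⨆ σ, f σ

/-- The supremum norm of the difference of two functions on the (finite) set of cells. -/
def supDist (f f' : Cells C → ℝ) : ℝ := ⨆ σ, |f σ - f' σ|

end Complex

/-! ### Contraction of a subspace -/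

section Contraction

variable {X : Type u} [TopologicalSpace X]

/-- The equivalence relation on the subspace `S` that identifies all points of `A ∩ S`. -/
def collapseSetoid (S A : Set X) : Setoid S where
  r x y := x = y ∨ ((x : X) ∈ A ∧ (y : X) ∈ A)
  iseqv :=
    { refl := fun _ => Or.inl rfl
      symm := by
        rintro x y (h | ⟨hx, hy⟩)
        · exact Or.inl h.symm
        · exact Or.inr ⟨hy, hx⟩
      trans := by
        rintro x y z (rfl | ⟨hx, hy⟩) (rfl | ⟨hy', hz⟩)
        · exact Or.inl rfl
        · exact Or.inr ⟨hy', hz⟩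
        · exact Or.inr ⟨hx, hy⟩
        · exact Or.inr ⟨hx, hz⟩ }

/-- The quotient space `S / A`, in which `A ∩ S` is contracted to one point, with the quotient
topology. If `A ∩ S` is empty, nothing is identified and this is the space `S`. -/
abbrev Contracted (S A : Set X) : Type u := Quotient (collapseSetoid S A)

/-- The map `S / A → S' / A'` induced by inclusions `S ⊆ S'` and `A ⊆ A'`. -/
def contractedMap {S S' A A' : Set X} (hS : S ⊆ S') (hA : A ⊆ A') :
    C(Contracted S A, Contracted S' A') where
  toFun := Quotient.map (sa := collapseSetoid S A) (sb := collapseSetoid S' A')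
    (Set.inclusion hS) (by
      rintro x y (rfl | ⟨hx, hy⟩)
      · exact Or.inl rfl
      · exact Or.inr ⟨hA hx, hA hy⟩)
  continuous_toFun := (continuous_inclusion hS).quotient_map' _

end Contraction

/-! ### The sequence of inclusions and contractions -/

section Sequence

variable {X : Type u} [TopologicalSpace X] {C : Set X} [CWComplex C] [Finite (Cells C)]

/-- The function times of the steps: the values of `f` (inclusion steps) and the numbers
`max f + a`, with `a` a value of `g` (contraction steps). If `g > 0`, the latter come after
the former. -/
def fbTimes (f g : Cells C → ℝ) : Finset ℝ :=
  ((Set.finite_range f).union (Set.finite_range fun σ => maxVal f + g σ)).toFinset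

/-- The number of steps. -/
abbrev fbSteps (f g : Cells C → ℝ) : ℕ := (fbTimes f g).card

/-- The function time of the `i`-th step: the steps are enumerated in increasing order. -/
def fbTime (f g : Cells C → ℝ) : Fin (fbSteps f g) ↪o ℝ := (fbTimes f g).orderEmbOfFin rfl

/-- The sequence of spaces of `(f, g)`-forward-backward persistence. With `t` the function time of
step `i`, the space at step `i` is `{f ≤ t} / {g ≤ t - max f}`. So (for `g > 0`) an inclusion step
with value `a` of `f` gives the subcomplex `{f ≤ a}`, and a contraction step with value `a` of `g`
gives the quotient of the whole complex in which the subcomplex `{g ≤ a}`, that is, everything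
contracted so far together with the cells of value `a` and their closures, is one point. -/
def fbSequence (f g : Cells C → ℝ) : Fin (fbSteps f g) ⥤ TopCat.{u} where
  obj i := TopCat.of
    (Contracted (sublevel f (fbTime f g i)) (sublevel g (fbTime f g i - maxVal f)))
  map {i j} h := TopCat.ofHom <| contractedMap
    (sublevel_mono f ((fbTime f g).monotone (leOfHom h)))
    (sublevel_mono g (sub_le_sub_right ((fbTime f g).monotone (leOfHom h)) _))
  map_id i := by
    ext x
    induction x using Quotient.inductionOn
    rfl
  map_comp a b := by
    ext x
    induction x using Quotient.inductionOn
    rfl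

/-- The `k`-th persistence module: singular homology `H_k` with coefficients in `ℤ/2`, applied to
the sequence of spaces. -/
def fbModule (f g : Cells C → ℝ) (k : ℕ) : Fin (fbSteps f g) ⥤ ModuleCat.{u} (ZMod 2) :=
  fbSequence f g ⋙ (AlgebraicTopology.singularHomologyFunctor (ModuleCat.{u} (ZMod 2)) k).obj
    (ModuleCat.of (ZMod 2) (ULift.{u} (ZMod 2)))

end Sequence

/-! ### Persistence diagrams -/

/-- The family of pairs (birth step, death step) `D` is the persistence diagram, in combinatorial
time, of the sequence of vector spaces `M 0 → M 1 → ⋯`, as read off an interval decomposition: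
the pair `D i = (b, d)` has a generator in `M b` whose image vanishes in `M t` for `t ≥ d`, and for
every `t` the images in `M t` of the generators with `b ≤ t < d` form a basis. A death step `⊤`
means that the class never dies. -/
def IsPersistenceDiagram {K : Type} [Field K] {N : ℕ} (M : Fin N ⥤ ModuleCat.{u} K)
    {ι : Type v} (D : ι → Fin N × WithTop (Fin N)) : Prop :=
  (∀ i, ((D i).1 : WithTop (Fin N)) < (D i).2) ∧
  ∃ gen : ∀ i, M.obj (D i).1,
    (∀ (t : Fin N) (i : ι) (h : (D i).1 ≤ t), (D i).2 ≤ (t : WithTop (Fin N)) →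
      M.map (homOfLE h) (gen i) = 0) ∧
    ∀ t : Fin N,
      let alive : {i // (D i).1 ≤ t ∧ (t : WithTop (Fin N)) < (D i).2} → M.obj t :=
        fun i => M.map (homOfLE i.2.1) (gen i)
      LinearIndependent K alive ∧ Submodule.span K (Set.range alive) = ⊤

/-- Replace the steps `(i, j)` by their function times `(a i, a j)`; `⊤` stays `⊤`. -/
def toFunctionTime {N : ℕ} (a : Fin N → ℝ) (p : Fin N × WithTop (Fin N)) : ℝ × WithTop ℝ :=
  (a p.1, p.2.map a)

/-- `D` is the `k`-th `(f, g)`-forward-backward persistence diagram in function time. -/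
def IsFBDiagram {X : Type u} [TopologicalSpace X] {C : Set X} [CWComplex C] [Finite (Cells C)]
    (f g : Cells C → ℝ) (k : ℕ) {ι : Type v} (D : ι → ℝ × WithTop ℝ) : Prop :=
  ∃ D₀ : ι → Fin (fbSteps f g) × WithTop (Fin (fbSteps f g)),
    IsPersistenceDiagram (fbModule f g k) D₀ ∧ ∀ i, D i = toFunctionTime (fbTime f g) (D₀ i)

/-! ### The bottleneck distance -/

/-- The distance of `p` and `q` in the supremum norm is at most `δ`, where `|⊤ - ⊤| = 0` and
`|⊤ - x| = ∞` for real `x`. -/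
def WithinDist (δ : ℝ) (p q : ℝ × WithTop ℝ) : Prop :=
  |p.1 - q.1| ≤ δ ∧ p.2 ≤ q.2 + (δ : WithTop ℝ) ∧ q.2 ≤ p.2 + (δ : WithTop ℝ)

/-- The distance of `p = (b, d)` to the diagonal in the supremum norm, `(d - b) / 2`, is at most
`δ`. -/
def NearDiagonal (δ : ℝ) (p : ℝ × WithTop ℝ) : Prop := p.2 ≤ ((p.1 + 2 * δ : ℝ) : WithTop ℝ)

/-- A bijection between the two diagrams, with points of the diagonal added to both as needed,
that moves no point by more than `δ`: points matched by `m` are at distance at most `δ`, and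
all others are matched with the diagonal. -/
structure IsMatching {ι κ : Type*} (δ : ℝ) (D : ι → ℝ × WithTop ℝ) (D' : κ → ℝ × WithTop ℝ)
    (m : ι ≃. κ) : Prop where
  matched : ∀ i j, m i = some j → WithinDist δ (D i) (D' j)
  unmatched_left : ∀ i, m i = none → NearDiagonal δ (D i)
  unmatched_right : ∀ j, m.symm j = none → NearDiagonal δ (D' j)

/-- The bottleneck distance of two persistence diagrams. -/
def bottleneckDist {ι κ : Type*} (D : ι → ℝ × WithTop ℝ) (D' : κ → ℝ × WithTop ℝ) : ENNReal :=
  ⨅ (δ : NNReal) (_ : ∃ m : ι ≃. κ, IsMatching (δ : ℝ) D D' m), (δ : ENNReal)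

end FBPersistence

end

/-! Extend the sequence to all real `t` by the spaces `{f ≤ t} / {g ≤ t - max f}`. Nothing changes
between function times, so a diagram in function time is a barcode of the resulting module over `ℝ`.
If `δ` is at least `‖f - f'‖` and at least `‖g - g'‖ + |max f - max f'|`, then `{f ≤ t} ⊆ {f' ≤ t +
δ}` and `{g ≤ t - max f} ⊆ {g' ≤ t + δ - max f'}`, and symmetrically. All maps come from inclusions,
so the two modules are `δ`-interleaved, and algebraic stability gives a `δ`-matching.

Algebraic stability is proved by linear algebra (`card_le_card_near`). With respect to the barcodes,
the interleaving maps become matrices `c` and `e`. Over a set `A` of long bars ordered by midpoint,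
the product of `c` and `e` is unitriangular, and only bars close to `A` contribute to the entries
that matter. So at least `#A` bars are close to `A`, which is Hall's condition. Vector spaces may be
infinite-dimensional, hence Hall's theorem is needed for infinite graphs with finitely many types of
vertices (`exists_injective_of_finite_types`), and a Cantor–Bernstein argument merges the injections
from both sides (`exists_pequiv_covering`).

Bars exist because each step is filtered by birth and death, and bases of the graded pieces serve as
generators (`exists_isPersistenceDiagram`). -/

noncomputable section

namespace FBPersistence

/-! ### Existence of interval decompositions -/

section Existence

/-- A subspace `W` is generated, modulo `L`, by a linearly independent subset of `W` whose span
is disjoint from `L`. -/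
theorem exists_basis_modulo {K V : Type*} [Field K] [AddCommGroup V] [Module K V]
    (W L : Submodule K V) :
    ∃ B : Set V, B ⊆ W ∧ LinearIndepOn K id B ∧ Disjoint (Submodule.span K B) L ∧
      W ≤ Submodule.span K B ⊔ L := by
  -- By modularity `Q ⊓ W` is a complement of `W ⊓ L` inside `W`; `B` is a basis of it.
  obtain ⟨Q, hQ⟩ := (W ⊓ L).exists_isCompl
  obtain ⟨B, hB, hspan, hli⟩ := exists_linearIndependent K ((Q ⊓ W : Submodule K V) : Set V)
  rw [Submodule.span_eq] at hspan
  refine ⟨B, fun x hx => (hB hx).2, hli, ?_, ?_⟩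
  · rw [hspan, disjoint_iff_inf_le]
    rintro x ⟨⟨hxQ, hxW⟩, hxL⟩
    exact hQ.disjoint.le_bot ⟨⟨hxW, hxL⟩, hxQ⟩
  · rw [hspan]
    intro x hx
    obtain ⟨y, hy, z, hz, rfl⟩ := Submodule.mem_sup.1 (hQ.sup_eq_top ▸ Submodule.mem_top (x := x))
    refine add_comm y z ▸ Submodule.add_mem_sup ⟨hz, ?_⟩ hy.2
    simpa using W.sub_mem hx hy.1

variable {K : Type} [Field K] {N : ℕ} (M : Fin N ⥤ ModuleCat.{u} K)

/-- The vectors at step `b` that vanish at all the steps from `d` on. -/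
def deadBy (b : Fin N) (d : WithTop (Fin N)) : Submodule K (M.obj b) :=
  ⨅ (t : Fin N) (h : b ≤ t) (_ : d ≤ t), LinearMap.ker (M.map (homOfLE h)).hom

theorem mem_deadBy {b : Fin N} {d : WithTop (Fin N)} {x : M.obj b} :
    x ∈ deadBy M b d ↔ ∀ (t : Fin N) (h : b ≤ t), d ≤ t → M.map (homOfLE h) x = 0 := by
  simp [deadBy, Submodule.mem_iInf]

/-- The vectors at step `b` that are generated by vectors born before `b` and by vectors that
vanish before `d`. -/
def olderOrDeadBefore (b : Fin N) (d : WithTop (Fin N)) : Submodule K (M.obj b) :=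
  (⨆ (s : Fin N) (h : s < b), LinearMap.range (M.map (homOfLE h.le)).hom) ⊔
    ⨆ (e : WithTop (Fin N)) (_ : e < d), deadBy M b e

theorem map_mem_olderOrDeadBefore {s b : Fin N} (h : s < b) (d : WithTop (Fin N)) (x : M.obj s) :
    M.map (homOfLE h.le) x ∈ olderOrDeadBefore M b d :=
  Submodule.mem_sup_left <| Submodule.mem_iSup_of_mem s <| Submodule.mem_iSup_of_mem h ⟨x, rfl⟩

theorem deadBy_le_olderOrDeadBefore (b : Fin N) {e d : WithTop (Fin N)} (h : e < d) :
    deadBy M b e ≤ olderOrDeadBefore M b d :=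
  le_sup_of_le_right <| le_iSup₂_of_le e h le_rfl

theorem map_map_apply {P : Type*} [Preorder P] (M : P ⥤ ModuleCat.{u} K) {r s t : P} (h : r ≤ s)
    (h' : s ≤ t) (x : M.obj r) :
    M.map (homOfLE h') (M.map (homOfLE h) x) = M.map (homOfLE (h.trans h')) x := by
  rw [← ModuleCat.comp_apply, ← M.map_comp]
  rfl

theorem map_refl_apply {P : Type*} [Preorder P] (M : P ⥤ ModuleCat.{u} K) {t : P} (h : t ≤ t)
    (x : M.obj t) : M.map (homOfLE h) x = x := by
  have : M.map (homOfLE h) = 𝟙 _ := M.map_id t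
  rw [this]
  rfl

/-- The vectors of an indexed family, transported forward from their births. -/
def transport {P : Type*} [Preorder P] [DecidableLE P] (M : P ⥤ ModuleCat.{u} K) {ι : Type*}
    (b : ι → P) (gen : ∀ i, M.obj (b i)) (i : ι) (t : P) : M.obj t :=
  if h : b i ≤ t then M.map (homOfLE h) (gen i) else 0

section Transport

variable {P : Type*} [Preorder P] [DecidableLE P] (M : P ⥤ ModuleCat.{u} K) {ι : Type*}
    (b : ι → P) (gen : ∀ i, M.obj (b i))

theorem transport_of_le {i : ι} {t : P} (h : b i ≤ t) :
    transport M b gen i t = M.map (homOfLE h) (gen i) := dif_pos h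

theorem map_transport {i : ι} {s t : P} (h : b i ≤ s) (h' : s ≤ t) :
    M.map (homOfLE h') (transport M b gen i s) = transport M b gen i t := by
  rw [transport_of_le M b gen h, transport_of_le M b gen (h.trans h'), map_map_apply]

end Transport

/-- Every finite sequence of vector spaces, of any dimension, has a persistence diagram. -/
theorem exists_isPersistenceDiagram :
    ∃ (ι : Type u) (D : ι → Fin N × WithTop (Fin N)), IsPersistenceDiagram M D := by
  classical
  choose B hBW hBli hBdisj hBspan using
    fun (b : Fin N) (d : WithTop (Fin N)) => exists_basis_modulo (deadBy M b d)
      (olderOrDeadBefore M b d)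
  let ι : Type u :=
    Σ p : {p : Fin N × WithTop (Fin N) // (p.1 : WithTop (Fin N)) < p.2}, B p.1.1 p.1.2
  let D : ι → Fin N × WithTop (Fin N) := fun i => i.1.1
  let gen : ∀ i : ι, M.obj (D i).1 := fun i => i.2.1
  let v := transport M (fun i => (D i).1) gen
  have hgen : ∀ i, gen i ∈ deadBy M (D i).1 (D i).2 := fun i => hBW _ _ i.2.2
  have hv : ∀ p x, v ⟨p, x⟩ p.1.1 = x.1 := fun p x =>
    (transport_of_le M _ gen (i := ⟨p, x⟩) le_rfl).trans (map_refl_apply M _ _)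
  have hzero : ∀ (i : ι) (t : Fin N), (D i).1 ≤ t → (D i).2 ≤ t → v i t = 0 := fun i t h h' =>
    (transport_of_le M _ gen h).trans ((mem_deadBy M).1 (hgen i) t h h')
  let alive : Fin N → Set ι := fun t => {i | (D i).1 ≤ t ∧ (t : WithTop (Fin N)) < (D i).2}
  have hli : ∀ t, LinearIndepOn K (fun i => v i t) (alive t) := by
    intro t
    rw [linearIndepOn_iff']
    intro s c hs hc
    by_contra! hne
    obtain ⟨j, hjs, hj⟩ := hne
    -- In a nontrivial relation, take a term with the lexicographically largest pair `(b, d)` of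
    -- birth and death. All other terms are then older, or die before `d`, or have the same pair.
    obtain ⟨i₀, hi₀, hmax⟩ := (s.filter (c · ≠ 0)).exists_max_image (fun i => toLex (D i))
      ⟨j, by simp [hjs, hj]⟩
    obtain ⟨p, x₀⟩ := i₀
    have hps := hs (Finset.mem_filter.1 hi₀).1
    let b := p.1.1
    let d := p.1.2
    have hle : ∀ i ∈ s.filter (c · ≠ 0), (D i).1 < b ∨ (D i).1 = b ∧ (D i).2 ≤ d := fun i hi =>
      (Prod.Lex.toLex_le_toLex).1 (hmax i hi)
    have hleb : ∀ i ∈ s.filter (c · ≠ 0), (D i).1 ≤ b := fun i hi =>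
      (hle i hi).elim le_of_lt fun h => h.1.le
    -- Pulled back to step `b`, the relation need not hold, but its left side dies by `t < d`.
    -- Modulo `olderOrDeadBefore M b d` only the terms with pair `(b, d)` survive, and these are
    -- independent by the choice of `B b d`.
    have hw : ∑ i ∈ s.filter (c · ≠ 0), c i • v i b ∈ deadBy M b t := by
      rw [mem_deadBy]
      intro t' hbt' htt'
      have htt' : t ≤ t' := by exact_mod_cast htt'
      have : M.map (homOfLE htt') (∑ i ∈ s, c i • v i t) = 0 := by rw [hc, map_zero]
      rw [map_sum] at this ⊢
      rw [← this, Finset.sum_filter]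
      refine Finset.sum_congr rfl fun i hi => ?_
      split_ifs with h
      · rw [map_smul, map_smul, map_transport M _ gen (hleb i (by simp [hi, h])),
          map_transport M _ gen (hs hi).1]
      · simp [not_not.1 h]
    have hL := deadBy_le_olderOrDeadBefore M b hps.2 hw
    rw [← Finset.sum_filter_add_sum_filter_not _ (fun i => i.1 = p)] at hL
    have hrest : ∑ i ∈ (s.filter (c · ≠ 0)).filter (fun i => ¬ i.1 = p), c i • v i b ∈
        olderOrDeadBefore M b d := by
      refine Submodule.sum_mem _ fun i hi => Submodule.smul_mem _ _ ?_
      obtain ⟨hi, hip⟩ := Finset.mem_filter.1 hi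
      rcases hle i hi with h | ⟨h, h'⟩
      · rw [show v i b = _ from transport_of_le M _ gen h.le]
        exact map_mem_olderOrDeadBefore M h d _
      · have hlt : (D i).2 < d := h'.lt_of_ne fun h' => hip (Subtype.ext (Prod.ext h h'))
        refine deadBy_le_olderOrDeadBefore M b hlt ?_
        rw [mem_deadBy]
        intro t hbt hdt
        rw [show M.map (homOfLE hbt) (v i b) = v i t from map_transport M _ gen h.le hbt]
        exact hzero i t (h.le.trans hbt) hdt
    have hmain := (Submodule.add_mem_iff_left _ hrest).1 hL
    have hinj : Function.Injective (fun x : B b d => (⟨p, x⟩ : ι)) :=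
      fun x y h => eq_of_heq (Sigma.mk.inj h).2
    rw [← Finset.sum_preimage (fun x : B b d => (⟨p, x⟩ : ι)) _ hinj.injOn] at hmain
    · have hspan : ∑ x ∈ ((s.filter (c · ≠ 0)).filter (fun i => i.1 = p)).preimage
          (fun x : B b d => (⟨p, x⟩ : ι)) hinj.injOn, c ⟨p, x⟩ • v ⟨p, x⟩ b ∈
          Submodule.span K (B b d) := by
        refine Submodule.sum_mem _ fun x _ => Submodule.smul_mem _ _ ?_
        rw [hv p x]
        exact Submodule.subset_span x.2
      have h0 := Submodule.disjoint_def.1 (hBdisj b d) _ hspan hmain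
      have hli := linearIndependent_iff'.1 (hBli b d) _ (fun x => c ⟨p, x⟩) (by
        rw [← h0]
        exact Finset.sum_congr rfl fun x _ => by rw [hv p x]; rfl) x₀ (by
          simpa using Finset.mem_filter.1 hi₀)
      exact (Finset.mem_filter.1 hi₀).2 hli
    · rintro ⟨q, y⟩ hq hnot
      obtain rfl : q = p := (Finset.mem_filter.1 hq).2
      exact absurd ⟨y, rfl⟩ hnot
  have hspan : ∀ b, (⊤ : Submodule K (M.obj b)) ≤
      Submodule.span K ((fun i => v i b) '' alive b) := by
    intro b
    induction b using WellFoundedLT.induction with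
    | _ b ih =>
    -- Inner induction on the death: vectors dead by `d` come from `B b d`, from earlier steps or
    -- from smaller deaths. For `d ≤ b` there is only the zero vector, and for `d = ⊤` the condition
    -- is void, which gives the whole space.
    have key : ∀ d : WithTop (Fin N),
        deadBy M b d ≤ Submodule.span K ((fun i => v i b) '' alive b) := by
      intro d
      induction d using WellFoundedLT.induction with
      | _ d ih' =>
      by_cases hbd : (b : WithTop (Fin N)) < d
      · refine (hBspan b d).trans (sup_le (Submodule.span_le.2 fun x hx => ?_) (sup_le ?_ ?_))
        · exact Submodule.subset_span ⟨⟨⟨(b, d), hbd⟩, ⟨x, hx⟩⟩, ⟨le_rfl, hbd⟩, hv _ _⟩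
        · refine iSup₂_le fun s hs => ?_
          rw [LinearMap.range_eq_map]
          refine (Submodule.map_mono (ih s hs)).trans ?_
          rw [Submodule.map_span, Submodule.span_le]
          rintro _ ⟨_, ⟨i, hi, rfl⟩, rfl⟩
          have : (M.map (homOfLE hs.le)).hom (v i s) = v i b := map_transport M _ gen hi.1 hs.le
          simp only [this]
          by_cases hd : (D i).2 ≤ b
          · rw [hzero i b (hi.1.trans hs.le) hd]
            exact Submodule.zero_mem _
          · exact Submodule.subset_span ⟨i, ⟨hi.1.trans hs.le, not_le.1 hd⟩, rfl⟩
        · exact iSup₂_le ih'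
      · intro x hx
        have := (mem_deadBy M).1 hx b le_rfl (not_lt.1 hbd)
        rw [map_refl_apply] at this
        rw [this]
        exact Submodule.zero_mem _
    refine le_trans (fun x _ => ?_) (key ⊤)
    rw [mem_deadBy]
    intro t _ h
    simp at h
  refine ⟨ι, D, fun i => i.1.2, gen, fun t i h h' => ?_, fun t => ?_⟩
  · exact (transport_of_le M _ gen h).symm.trans (hzero i t h h')
  · have heq : (fun i : {i // (D i).1 ≤ t ∧ (t : WithTop (Fin N)) < (D i).2} =>
        M.map (homOfLE i.2.1) (gen i)) = fun i : alive t => v i t :=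
      funext fun i => (transport_of_le M _ gen i.2.1).symm
    refine ⟨?_, ?_⟩
    · rw [heq]
      exact hli t
    · rw [heq, eq_top_iff]
      convert hspan t using 2
      rw [Set.image_eq_range]

end Existence

/-! ### Matchings in bipartite graphs with finitely many types of vertices -/

section Matching

open Cardinal

/-- Two injections, defined on parts of `ι` and of `κ`, that respect a relation `E` can be combined
into a matching that respects `E` and covers both parts. -/
theorem exists_pequiv_covering {ι κ : Type*} (E : ι → κ → Prop) (A : Set ι) (B : Set κ)
    (f : A → κ) (hf : f.Injective) (hfE : ∀ i : A, E i (f i))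
    (g : B → ι) (hg : g.Injective) (hgE : ∀ j : B, E (g j) j) :
    ∃ m : ι ≃. κ, (∀ i j, m i = some j → E i j) ∧ (∀ i ∈ A, m i ≠ none) ∧
      ∀ j ∈ B, m.symm j ≠ none := by
  classical
  -- The least fixed point `Z` consists of the indices reached from `A` outside the range of `g` by
  -- alternating `f` and `g`. The matching uses `f` on `Z` and the inverse of `g` off `Z`; `hZg`
  -- shows that the two halves do not collide.
  let F : Set ι →o Set ι :=
    { toFun := fun Z => {i | (i ∈ A ∧ i ∉ Set.range g) ∨
        ∃ (z : A) (h : f z ∈ B), z.1 ∈ Z ∧ g ⟨f z, h⟩ = i}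
      monotone' := fun Z Z' h i hi => hi.imp_right fun ⟨z, hz, hzZ, e⟩ => ⟨z, hz, h hzZ, e⟩ }
  let Z := OrderHom.lfp F
  have hZ : ∀ i, i ∈ Z ↔ (i ∈ A ∧ i ∉ Set.range g) ∨
      ∃ (z : A) (h : f z ∈ B), z.1 ∈ Z ∧ g ⟨f z, h⟩ = i := fun i => by
    conv_lhs => rw [show Z = F Z from F.map_lfp.symm]
    rfl
  have hZg : ∀ j : B, g j ∈ Z ↔ ∃ z : A, z.1 ∈ Z ∧ f z = j := by
    intro j
    rw [hZ]
    constructor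
    · rintro (h | ⟨z, hz, hzZ, e⟩)
      · exact absurd ⟨j, rfl⟩ h.2
      · exact ⟨z, hzZ, congrArg Subtype.val (hg e)⟩
    · rintro ⟨z, hzZ, e⟩
      exact Or.inr ⟨z, e ▸ j.2, hzZ, congrArg g (Subtype.ext e)⟩
  let R : ι → κ → Prop := fun i j =>
    (∃ h : i ∈ A, i ∈ Z ∧ f ⟨i, h⟩ = j) ∨ (∃ h : j ∈ B, i ∉ Z ∧ g ⟨j, h⟩ = i)
  have hR1 : ∀ i j j', R i j → R i j' → j = j' := by
    rintro i j j' (⟨h, hi, rfl⟩ | ⟨h, hi, e⟩) (⟨h', hi', rfl⟩ | ⟨h', hi', e'⟩)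
    · rfl
    · exact absurd hi hi'
    · exact absurd hi' hi
    · exact congrArg Subtype.val (hg (e.trans e'.symm))
  have hR3 : ∀ i i' j, i ∈ Z → i' ∉ Z → R i j → R i' j → False := by
    rintro i i' j hi hi' (⟨h, _, e⟩ | ⟨h, hn, e⟩) (⟨h', hy, e'⟩ | ⟨h', hn', e'⟩)
    · exact hi' hy
    · exact hi' (e' ▸ (hZg ⟨j, h'⟩).2 ⟨⟨i, h⟩, hi, e⟩)
    · exact hn hi
    · exact hn hi
  have hR2 : ∀ i i' j, R i j → R i' j → i = i' := by
    intro i i' j h h'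
    by_cases hi : i ∈ Z <;> by_cases hi' : i' ∈ Z
    · obtain ⟨a, _, e⟩ | ⟨_, hn, _⟩ := h
      · obtain ⟨a', _, e'⟩ | ⟨_, hn, _⟩ := h'
        · exact congrArg Subtype.val (hf (e.trans e'.symm))
        · exact absurd hi' hn
      · exact absurd hi hn
    · exact (hR3 i i' j hi hi' h h').elim
    · exact (hR3 i' i j hi' hi h' h).elim
    · obtain ⟨_, hy, _⟩ | ⟨a, _, e⟩ := h
      · exact absurd hy hi
      · obtain ⟨_, hy, _⟩ | ⟨a', _, e'⟩ := h'
        · exact absurd hy hi'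
        · exact e.symm.trans e'
  let m : ι ≃. κ :=
    { toFun := fun i => if h : ∃ j, R i j then some h.choose else none
      invFun := fun j => if h : ∃ i, R i j then some h.choose else none
      inv := by
        intro i j
        constructor
        · intro h
          split_ifs at h with h'
          obtain rfl := Option.some.inj h
          have : ∃ j, R h'.choose j := ⟨j, h'.choose_spec⟩
          rw [dif_pos this]
          exact congrArg some (hR1 _ _ _ this.choose_spec h'.choose_spec)
        · intro h
          split_ifs at h with h'
          obtain rfl := Option.some.inj h
          have : ∃ i, R i h'.choose := ⟨i, h'.choose_spec⟩
          rw [dif_pos this]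
          exact congrArg some (hR2 _ _ _ this.choose_spec h'.choose_spec) }
  have hm : ∀ i j, R i j → m i = some j := fun i j h => by
    have h' : ∃ j, R i j := ⟨j, h⟩
    change (if h : ∃ j, R i j then some h.choose else none) = some j
    rw [dif_pos h']
    exact congrArg some (hR1 _ _ _ h'.choose_spec h)
  refine ⟨m, fun i j h => ?_, fun i hi => ?_, fun j hj => ?_⟩
  · change (if h : ∃ j, R i j then some h.choose else none) = some j at h
    split_ifs at h with h'
    obtain rfl := Option.some.inj h
    obtain ⟨hA, _, e⟩ | ⟨hB, _, e⟩ := h'.choose_spec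
    · exact e ▸ hfE ⟨i, hA⟩
    · have := hgE ⟨_, hB⟩
      rwa [e] at this
  · by_cases hiZ : i ∈ Z
    · rw [hm i _ (Or.inl ⟨hi, hiZ, rfl⟩)]
      simp
    · have : i ∈ Set.range g := by
        by_contra h
        exact hiZ ((hZ i).2 (Or.inl ⟨hi, h⟩))
      obtain ⟨j, rfl⟩ := this
      rw [hm _ j (Or.inr ⟨j.2, hiZ, rfl⟩)]
      simp
  · have : ∃ i, R i j := by
      by_cases h : g ⟨j, hj⟩ ∈ Z
      · obtain ⟨z, hz, e⟩ := (hZg _).1 h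
        exact ⟨z, Or.inl ⟨z.2, hz, e⟩⟩
      · exact ⟨_, Or.inr ⟨hj, h, rfl⟩⟩
    obtain ⟨i, hi⟩ := this
    rw [(m.eq_some_iff).2 (hm i j hi)]
    simp

/-- Hall's theorem for bipartite graphs, possibly infinite, in which there are finitely many types
of vertices and adjacency depends on the types only. -/
theorem exists_injective_of_finite_types {ι κ : Type u} {S T : Type*} [Finite S] [Finite T]
    (D : ι → S) (D' : κ → T) (E : S → T → Prop)
    (hall : ∀ A : Set ι, #A ≤ #{j | ∃ i ∈ A, E (D i) (D' j)}) :
    ∃ f : ι → κ, f.Injective ∧ ∀ i, E (D i) (D' (f i)) := by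
  classical
  rcases isEmpty_or_nonempty T with hT | hT
  · have : IsEmpty ι := ⟨fun i => by
      have : IsEmpty κ := ⟨fun j => hT.elim (D' j)⟩
      simpa [mk_eq_zero] using hall {i}⟩
    exact ⟨isEmptyElim, fun i => isEmptyElim i, fun i => isEmptyElim i⟩
  -- Vertices that are not `big` have finite neighbourhoods, so the finite Hall theorem applies to
  -- them. The `big` ones are sent into infinite fibres by comparing cardinals.
  let big : ι → Prop := fun i => ∃ t, E (D i) t ∧ (D' ⁻¹' {t}).Infinite
  have hsmall : ∃ f : {i // ¬ big i} → κ, f.Injective ∧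
      ∀ i : {i // ¬ big i}, E (D i) (D' (f i)) := by
    have hfin : ∀ i : {i // ¬ big i}, {j | E (D i) (D' j)}.Finite := by
      intro i
      have : {j | E (D i) (D' j)} = ⋃ t ∈ {t | E (D i) t}, D' ⁻¹' {t} := by
        ext j
        simp
      rw [this]
      refine (Set.toFinite _).biUnion fun t ht => ?_
      by_contra h
      exact i.2 ⟨t, ht, h⟩
    obtain ⟨f, hf, hf'⟩ := (Finset.all_card_le_biUnion_card_iff_exists_injective
      (fun i => (hfin i).toFinset)).1 (by
        intro s
        have h := hall (Subtype.val '' (s : Set {i // ¬ big i}))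
        have e : {j | ∃ i ∈ Subtype.val '' (s : Set {i // ¬ big i}), E (D i) (D' j)} =
            ((s.biUnion fun i => (hfin i).toFinset : Finset κ) : Set κ) := by
          ext j
          simp
        rw [e, mk_image_eq Subtype.val_injective] at h
        simpa only [Finset.coe_sort_coe, mk_coe_finset, Nat.cast_le] using h)
    exact ⟨f, hf, fun i => by simpa using hf' i⟩
  -- Otherwise the neighbours of the whole fibre over `s` form a finite union of sets smaller than
  -- this infinite fibre, against Hall's condition.
  have hbig : ∀ s : S, (∃ i, D i = s ∧ big i) →
      ∃ t, E s t ∧ (D' ⁻¹' {t}).Infinite ∧ #(D ⁻¹' {s}) ≤ #(D' ⁻¹' {t}) := by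
    rintro s ⟨i, rfl, t₀, ht₀, hinf₀⟩
    by_contra! hlt
    have hE : ∀ t, E (D i) t → #(D' ⁻¹' {t}) < #(D ⁻¹' {D i}) := by
      intro t ht
      by_cases hinf : (D' ⁻¹' {t}).Infinite
      · exact hlt t ht hinf
      · have h1 : #(D' ⁻¹' {t}) < ℵ₀ := (Set.not_infinite.1 hinf).lt_aleph0
        have h2 : ℵ₀ ≤ #(D' ⁻¹' {t₀}) := by
          have := hinf₀.to_subtype
          exact aleph0_le_mk _
        exact h1.trans_le (h2.trans (hlt t₀ ht₀ hinf₀).le)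
    have hinf : ℵ₀ ≤ #(D ⁻¹' {D i}) := by
      have := hinf₀.to_subtype
      exact (aleph0_le_mk _).trans (hE t₀ ht₀).le
    have h := hall (D ⁻¹' {D i})
    have e : {j | ∃ i' ∈ D ⁻¹' {D i}, E (D i') (D' j)} = ⋃ t : {t | E (D i) t}, D' ⁻¹' {t.1} := by
      ext j
      simp only [Set.mem_preimage, Set.mem_singleton_iff, Set.mem_ofPred_eq, Set.mem_iUnion,
        Subtype.exists, exists_prop, exists_eq_right']
      exact ⟨fun ⟨i', h, h'⟩ => h ▸ h', fun h => ⟨i, rfl, h⟩⟩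
    rw [e] at h
    have hlt' : #(⋃ t : {t | E (D i) t}, D' ⁻¹' {t.1}) < #(D ⁻¹' {D i}) := by
      have : Fintype {t | E (D i) t} := Fintype.ofFinite _
      rw [← Set.biUnion_univ, ← Finset.coe_univ]
      induction (Finset.univ : Finset {t | E (D i) t}) using Finset.induction_on with
      | empty => simpa using aleph0_pos.trans_le hinf
      | insert a s _ ih =>
        rw [Finset.coe_insert, Set.biUnion_insert]
        exact (mk_union_le _ _).trans_lt (add_lt_of_lt hinf (hE a a.2) ih)
    exact absurd h hlt'.not_ge
  choose! c hcE hcinf hcle using hbig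
  -- Finitely many types choose the same `t`, and an infinite cardinal absorbs the finite sum of
  -- their fibres.
  have hfib : ∀ t : T, ∃ f : {i | big i ∧ c (D i) = t} → D' ⁻¹' {t}, f.Injective := by
    intro t
    suffices h : #{i | big i ∧ c (D i) = t} ≤ #(D' ⁻¹' {t}) by
      obtain ⟨e⟩ := h
      exact ⟨e, e.injective⟩
    by_cases hne : ∃ i, big i ∧ c (D i) = t
    · obtain ⟨i, hi, rfl⟩ := hne
      have hinf : ℵ₀ ≤ #(D' ⁻¹' {c (D i)}) := by
        have := (hcinf (D i) ⟨i, rfl, hi⟩).to_subtype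
        exact aleph0_le_mk _
      have hQ : ∀ Q : Set S, Q.Finite → (∀ s ∈ Q, (∃ i, D i = s ∧ big i) ∧ c s = c (D i)) →
          #(⋃ s ∈ Q, D ⁻¹' {s} : Set ι) ≤ #(D' ⁻¹' {c (D i)}) := by
        intro Q hQ
        induction Q, hQ using Set.Finite.induction_on with
        | empty => simp
        | @insert a s _ _ ih =>
          intro h
          rw [Set.biUnion_insert]
          have ha := h a (Set.mem_insert a s)
          exact (mk_union_le _ _).trans (add_le_of_le hinf (ha.2 ▸ hcle a ha.1)
            (ih fun s' hs' => h s' (Set.mem_insert_of_mem a hs')))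
      refine (mk_le_mk_of_subset ?_).trans
        (hQ {s | (∃ i, D i = s ∧ big i) ∧ c s = c (D i)} (Set.toFinite _) fun _ h => h)
      rintro i' ⟨h, h'⟩
      simp only [Set.mem_iUnion]
      exact ⟨D i', ⟨⟨i', rfl, h⟩, h'⟩, rfl⟩
    · have : IsEmpty {i | big i ∧ c (D i) = t} := ⟨fun i => hne ⟨i.1, i.2⟩⟩
      rw [mk_eq_zero]
      exact zero_le
  choose φ hφ using hfib
  obtain ⟨ψ, hψ, hψE⟩ := hsmall
  let f : ι → κ := fun i => if h : big i then (φ (c (D i)) ⟨i, h, rfl⟩).1 else ψ ⟨i, h⟩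
  have hfpos : ∀ i (h : big i) t (ht : c (D i) = t), f i = (φ t ⟨i, h, ht⟩).1 := by
    rintro i h _ rfl
    exact dif_pos h
  have hfneg : ∀ i (h : ¬ big i), f i = ψ ⟨i, h⟩ := fun i h => dif_neg h
  have hfD : ∀ i, big i → D' (f i) = c (D i) := fun i h => by
    rw [hfpos i h _ rfl]
    exact (φ (c (D i)) ⟨i, h, rfl⟩).2
  -- Big vertices land in infinite fibres, while the others have no neighbour in one.
  have hne : ∀ i i', big i → ¬ big i' → f i ≠ f i' := by
    intro i i' h h' e
    refine h' ⟨D' (f i'), ?_, ?_⟩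
    · rw [hfneg i' h']
      exact hψE ⟨i', h'⟩
    · rw [← e, hfD i h]
      exact hcinf _ ⟨i, rfl, h⟩
  refine ⟨f, fun i i' e => ?_, fun i => ?_⟩
  · by_cases h : big i <;> by_cases h' : big i'
    · have hc : c (D i') = c (D i) := by rw [← hfD i h, ← hfD i' h', e]
      have := hφ _ (Subtype.ext ((hfpos i h _ rfl).symm.trans (e.trans (hfpos i' h' _ hc))))
      simpa using this
    · exact absurd e (hne i i' h h')
    · exact absurd e.symm (hne i' i h' h)
    · rw [hfneg i h, hfneg i' h'] at e
      simpa using hψ e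
  · by_cases h : big i
    · rw [hfD i h]
      exact hcE _ ⟨i, rfl, h⟩
    · rw [hfneg i h]
      exact hψE ⟨i, h⟩

end Matching

/-! ### Algebraic stability -/

section Stability

open Cardinal

variable {K : Type} [Field K]

/-- The indices of the bars that contain `t`. -/
def aliveAt {ι : Type*} (D : ι → ℝ × WithTop ℝ) (t : ℝ) : Set ι :=
  {i | (D i).1 ≤ t ∧ (t : WithTop ℝ) < (D i).2}

/-- The vectors `v i t` exhibit the persistence module `F` over `ℝ` as a direct sum of interval
modules, with endpoints given by `D`. -/
structure IsBarcode (F : ℝ ⥤ ModuleCat.{u} K) {ι : Type v} (D : ι → ℝ × WithTop ℝ)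
    (v : ι → ∀ t, F.obj t) : Prop where
  birth_lt_death : ∀ i, ((D i).1 : WithTop ℝ) < (D i).2
  map_apply : ∀ (i : ι) (s t : ℝ) (h : s ≤ t), (D i).1 ≤ s → F.map (homOfLE h) (v i s) = v i t
  eq_zero : ∀ i t, i ∉ aliveAt D t → v i t = 0
  linearIndepOn : ∀ t, LinearIndepOn K (fun i => v i t) (aliveAt D t)
  top_le_span : ∀ t, ⊤ ≤ Submodule.span K ((fun i => v i t) '' aliveAt D t)

/-- A morphism of persistence modules that raises the parameter by `δ` or more. -/
structure ShiftHom (F G : ℝ ⥤ ModuleCat.{u} K) (δ : ℝ) where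
  app : ∀ s t : ℝ, s + δ ≤ t → (F.obj s ⟶ G.obj t)
  map_app : ∀ (s s' t : ℝ) (h : s ≤ s') (h' : s' + δ ≤ t) (x : F.obj s),
    app s' t h' (F.map (homOfLE h) x) = app s t ((add_le_add_left h δ).trans h') x
  app_map : ∀ (s t t' : ℝ) (h : s + δ ≤ t) (h' : t ≤ t') (x : F.obj s),
    G.map (homOfLE h') (app s t h x) = app s t' (h.trans h') x

variable {F G : ℝ ⥤ ModuleCat.{u} K} {ι κ : Type u} {D : ι → ℝ × WithTop ℝ}
  {D' : κ → ℝ × WithTop ℝ} {v : ι → ∀ t, F.obj t} {w : κ → ∀ t, G.obj t} {δ : ℝ}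

/-- Bars not alive at `t` contribute the zero vector, so their coefficients are arbitrary and can be
dropped; the remaining vectors are independent. This permits comparing coefficients at `t` along
alive bars. -/
theorem IsBarcode.coeff_eq_zero (hv : IsBarcode F D v) {t : ℝ} {c : ι →₀ K}
    (hc : Finsupp.linearCombination K (fun i => v i t) c = 0) {i : ι} (hi : i ∈ aliveAt D t) :
    c i = 0 := by
  classical
  have h := linearIndepOn_iff.1 (hv.linearIndepOn t) (c.filter (· ∈ aliveAt D t))
    ((Finsupp.mem_supported K _).2 fun j hj => (Finset.mem_filter.1 hj).2) (by
      rw [← hc, Finsupp.linearCombination_apply, Finsupp.linearCombination_apply, Finsupp.sum,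
        Finsupp.sum, Finsupp.support_filter, Finset.sum_filter]
      refine Finset.sum_congr rfl fun j _ => ?_
      split_ifs with hj
      · rw [Finsupp.filter_apply_pos _ _ hj]
      · rw [hv.eq_zero j t hj, smul_zero])
  rw [← Finsupp.filter_apply_pos (· ∈ aliveAt D t) c hi, h, Finsupp.zero_apply]

/-- The matrix of a shifting morphism with respect to two barcodes. -/
theorem ShiftHom.exists_coeff (Φ : ShiftHom F G δ) (hv : IsBarcode F D v)
    (hw : IsBarcode G D' w) :
    ∃ c : ι → κ →₀ K,
      (∀ i j, c i j ≠ 0 → (D' j).1 ≤ (D i).1 + δ ∧ (((D i).1 + δ : ℝ) : WithTop ℝ) < (D' j).2 ∧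
        (D' j).2 ≤ (D i).2 + (δ : WithTop ℝ)) ∧
      ∀ i s t (h : s + δ ≤ t), (D i).1 ≤ s →
        Φ.app s t h (v i s) = Finsupp.linearCombination K (fun j => w j t) (c i) := by
  -- The coefficients are read off at the birth of `i`; naturality carries them to all later
  -- parameters.
  have hex : ∀ i, ∃ c ∈ Finsupp.supported K K (aliveAt D' ((D i).1 + δ)),
      Finsupp.linearCombination K (fun j => w j ((D i).1 + δ)) c =
        Φ.app (D i).1 ((D i).1 + δ) le_rfl (v i (D i).1) := fun i =>
    (Finsupp.mem_span_image_iff_linearCombination K).1 (hw.top_le_span _ trivial)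
  choose c hcs hc using hex
  have halive : ∀ i j, c i j ≠ 0 → j ∈ aliveAt D' ((D i).1 + δ) := fun i j h =>
    (Finsupp.mem_supported K _).1 (hcs i) (Finsupp.mem_support_iff.2 h)
  have hmap : ∀ i s t (h : s + δ ≤ t), (D i).1 ≤ s →
      Φ.app s t h (v i s) = Finsupp.linearCombination K (fun j => w j t) (c i) := by
    intro i s t h hs
    have ht : (D i).1 + δ ≤ t := (add_le_add_left hs δ).trans h
    rw [← hv.map_apply i _ s hs le_rfl, Φ.map_app, ← Φ.app_map _ _ t le_rfl ht, ← hc,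
      Finsupp.linearCombination_apply, Finsupp.linearCombination_apply, Finsupp.sum, Finsupp.sum,
      map_sum]
    refine Finset.sum_congr rfl fun j hj => ?_
    rw [map_smul, hw.map_apply j _ t ht (halive i j (Finsupp.mem_support_iff.1 hj)).1]
  refine ⟨c, fun i j h => ⟨(halive i j h).1, (halive i j h).2, ?_⟩, hmap⟩
  -- At the death `d` of `i` the vector is zero, so the combination vanishes at `d + δ`. A bar `j`
  -- still alive there has coefficient zero.
  by_contra! hlt
  obtain ⟨d, hd⟩ := WithTop.ne_top_iff_exists.1 (fun hd : (D i).2 = ⊤ => by simp [hd] at hlt)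
  have hbd := hv.birth_lt_death i
  rw [← hd] at hlt hbd
  have hbd : (D i).1 < d := by exact_mod_cast hbd
  have h0 := hmap i d (d + δ) le_rfl hbd.le
  rw [hv.eq_zero i d (fun h => by simpa [← hd] using h.2), map_zero] at h0
  exact h (hw.coeff_eq_zero h0.symm ⟨(halive i j h).1.trans (add_le_add_left hbd.le δ),
    by exact_mod_cast hlt⟩)

/-- If there are nonzero morphisms `I → J(δ)` and `J → I'(δ)` between interval modules, and the
midpoint of `I` does not come after that of `I'`, then `J` is `δ`-close to `I` or `I'`. -/
theorem withinDist_or_withinDist {p q p' : ℝ × WithTop ℝ}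
    (h1 : q.1 ≤ p.1 + δ) (h2 : q.2 ≤ p.2 + (δ : WithTop ℝ))
    (h3 : p'.1 ≤ q.1 + δ) (h4 : p'.2 ≤ q.2 + (δ : WithTop ℝ))
    (hle : toLex (p.1 + p.2, p.1) ≤ toLex (p'.1 + p'.2, p'.1)) :
    WithinDist δ p q ∨ WithinDist δ p' q := by
  obtain ⟨b, d⟩ := p
  obtain ⟨a, e⟩ := q
  obtain ⟨b', d'⟩ := p'
  simp only [WithinDist, Prod.Lex.toLex_le_toLex, abs_le] at *
  -- For finite deaths, if both alternatives fail, each combination of violated inequalities gives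
  -- `b' + d' < b + d`. An infinite `d` or `d'` forces all three deaths to be infinite, and failure
  -- then gives `b' < b`.
  induction d using WithTop.recTopCoe <;> induction d' using WithTop.recTopCoe <;>
    induction e using WithTop.recTopCoe <;>
    simp only [← WithTop.coe_add, WithTop.add_top, WithTop.top_add, WithTop.coe_lt_top,
      WithTop.coe_le_coe, WithTop.coe_lt_coe, WithTop.coe_inj, top_le_iff, le_top,
      WithTop.coe_ne_top, lt_irrefl, not_top_lt, WithTop.top_ne_coe, false_or, false_and, true_and,
      and_true, or_false] at hle h2 h4 ⊢
  all_goals try grind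

/-- If the midpoint of a long interval `p` does not come after that of a long interval `p'`, then
`p'` ends after `p.1 + 2δ`. -/
theorem lt_death_of_key_le {p p' : ℝ × WithTop ℝ} (h : ((p.1 + 2 * δ : ℝ) : WithTop ℝ) < p.2)
    (h' : ((p'.1 + 2 * δ : ℝ) : WithTop ℝ) < p'.2)
    (hle : toLex (p.1 + p.2, p.1) ≤ toLex (p'.1 + p'.2, p'.1)) :
    ((p.1 + δ + δ : ℝ) : WithTop ℝ) < p'.2 := by
  obtain ⟨b, d⟩ := p
  obtain ⟨b', d'⟩ := p'
  simp only [Prod.Lex.toLex_le_toLex] at *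
  induction d' using WithTop.recTopCoe with
  | top => exact WithTop.coe_lt_top _
  | coe d' =>
    induction d using WithTop.recTopCoe with
    | top => simp [← WithTop.coe_add] at hle
    | coe d =>
      -- If `d' ≤ b + 2δ`, then `d' < d` and `b' < d' - 2δ ≤ b`, contradicting the order of the
      -- midpoints.
      norm_cast at *
      grind

/-- For interleaved persistence modules, a set `A` of long bars of one has no more elements than
the set of bars of the other that are close to `A`. -/
theorem card_le_card_near (hδ : 0 ≤ δ) (Φ : ShiftHom F G δ) (Ψ : ShiftHom G F δ)
    (hΦΨ : ∀ (s t r : ℝ) (h : s + δ ≤ t) (h' : t + δ ≤ r) (x : F.obj s),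
      Ψ.app t r h' (Φ.app s t h x) = F.map (homOfLE (by linarith)) x)
    (hv : IsBarcode F D v) (hw : IsBarcode G D' w) (A : Set ι)
    (hA : ∀ i ∈ A, ¬ NearDiagonal δ (D i)) :
    #A ≤ #{j | ∃ i ∈ A, WithinDist δ (D i) (D' j)} := by
  classical
  obtain ⟨c, hc, hcmap⟩ := Φ.exists_coeff hv hw
  obtain ⟨e, he, hemap⟩ := Ψ.exists_coeff hw hv
  set N : Set κ := {j | ∃ i ∈ A, WithinDist δ (D i) (D' j)}
  -- Twice the midpoint; the birth breaks ties, in particular among infinite bars.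
  let key : ι → WithTop ℝ ×ₗ ℝ := fun i => toLex ((D i).1 + (D i).2, (D i).1)
  -- Going forth and back is the structure map from the birth of `i` to `t`, the birth plus `2δ`. If
  -- `i'` is born by then, it is alive at `t` and its coefficients can be compared; if it is born
  -- later, every summand vanishes.
  have hprod : ∀ i ∈ A, ∀ i' ∈ A, key i ≤ key i' →
      ∑ j ∈ (c i).support, c i j * e j i' = if i = i' then 1 else 0 := by
    intro i hi i' hi' hk
    have hlong := hA i hi
    have hlong' := hA i' hi'
    simp only [NearDiagonal, not_le] at hlong hlong'
    by_cases hb : (D i').1 ≤ (D i).1 + δ + δ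
    · set t := (D i).1 + δ + δ with ht
      have halive : i' ∈ aliveAt D t := ⟨hb, lt_death_of_key_le hlong hlong' hk⟩
      have h0 : Finsupp.linearCombination K (fun i => v i t)
          ((c i).sum (fun j a => a • e j) - Finsupp.single i 1) = 0 := by
        rw [map_sub, Finsupp.linearCombination_single, one_smul, sub_eq_zero,
          ← hv.map_apply i (D i).1 t (by linarith) le_rfl,
          ← hΦΨ _ ((D i).1 + δ) _ le_rfl le_rfl, hcmap _ _ _ _ le_rfl,
          Finsupp.linearCombination_apply K (c i), Finsupp.sum, Finsupp.sum, map_sum,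
          map_sum]
        refine Finset.sum_congr rfl fun j hj => ?_
        rw [map_smul, map_smul, hemap j _ _ _ (hc i j (Finsupp.mem_support_iff.1 hj)).1]
      have h1 := hv.coeff_eq_zero h0 halive
      rw [Finsupp.sub_apply, sub_eq_zero, Finsupp.sum, Finsupp.finsetSum_apply,
        Finsupp.single_apply] at h1
      simpa using h1
    · rw [if_neg (by rintro rfl; exact hb (by linarith))]
      refine Finset.sum_eq_zero fun j hj => ?_
      by_contra hne
      have h1 := hc i j (left_ne_zero_of_mul hne)
      have h2 := he j i' (right_ne_zero_of_mul hne)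
      exact hb (by linarith [h1.1, h2.1])
  have hrestrict : ∀ i ∈ A, ∀ i' ∈ A, key i ≤ key i' →
      Finsupp.linearCombination K (fun j : N => e j i') ((c i).subtypeDomain (· ∈ N)) =
        if i = i' then 1 else 0 := by
    intro i hi i' hi' hk
    rw [← hprod i hi i' hi' hk, Finsupp.linearCombination_apply, Finsupp.sum,
      Finsupp.support_subtypeDomain]
    simp only [Finsupp.subtypeDomain_apply, smul_eq_mul]
    rw [Finset.sum_subtype_eq_sum_filter (f := fun j => c i j * e j i'), Finset.sum_filter_of_ne]
    intro j _ hne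
    have h1 := hc i j (left_ne_zero_of_mul hne)
    have h2 := he j i' (right_ne_zero_of_mul hne)
    exact (withinDist_or_withinDist h1.1 h1.2.2 h2.1 h2.2.2 hk).elim (fun h => ⟨i, hi, h⟩)
      fun h => ⟨i', hi', h⟩
  have hli : LinearIndependent K (fun i : A => (c i).subtypeDomain (· ∈ N)) := by
    rw [linearIndependent_iff']
    intro s x hx
    by_contra! hne
    obtain ⟨i₁, hi₁, hne⟩ := hne
    -- Unitriangularity: pairing the relation with column `i'` of `e`, where `i'` has the largest
    -- key, leaves only the coefficient of `i'`.
    obtain ⟨i', hi', hmax⟩ := (s.filter (x · ≠ 0)).exists_max_image (fun i => key i)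
      ⟨i₁, by simp [hi₁, hne]⟩
    have h := congrArg (Finsupp.linearCombination K (fun j : N => e j i')) hx
    rw [map_zero, map_sum, ← Finset.sum_filter_of_ne (p := (x · ≠ 0)) (by
      intro i _ h h'
      simp [h'] at h), Finset.sum_congr rfl (g := fun i => if i = i' then x i' else 0)] at h
    · rw [Finset.sum_ite_eq' , if_pos hi'] at h
      exact (Finset.mem_filter.1 hi').2 h
    · intro i hi
      rw [map_smul, hrestrict i i.2 i' i'.2 (hmax i hi)]
      by_cases h : i = i'
      · simp [h]
      · simp [h, Subtype.coe_injective.ne h]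
  exact hli.cardinal_le_rank.trans_eq (by simp)

/-- **Algebraic stability** for persistence modules with finitely many types of bars: if the modules
are `δ`-interleaved, then there is a `δ`-matching of their diagrams. -/
theorem exists_isMatching (hδ : 0 ≤ δ) (Φ : ShiftHom F G δ) (Ψ : ShiftHom G F δ)
    (hΦΨ : ∀ (s t r : ℝ) (h : s + δ ≤ t) (h' : t + δ ≤ r) (x : F.obj s),
      Ψ.app t r h' (Φ.app s t h x) = F.map (homOfLE (by linarith)) x)
    (hΨΦ : ∀ (s t r : ℝ) (h : s + δ ≤ t) (h' : t + δ ≤ r) (x : G.obj s),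
      Φ.app t r h' (Ψ.app s t h x) = G.map (homOfLE (by linarith)) x)
    (hv : IsBarcode F D v) (hw : IsBarcode G D' w)
    (hD : (Set.range D).Finite) (hD' : (Set.range D').Finite) :
    ∃ m : ι ≃. κ, IsMatching δ D D' m := by
  have hcomm : ∀ p q, WithinDist δ p q → WithinDist δ q p := fun p q h =>
    ⟨abs_sub_comm p.1 q.1 ▸ h.1, h.2.2, h.2.1⟩
  -- The vertex types are the points of the diagrams. There are finitely many, though each may have
  -- infinite multiplicity.
  have aux : ∀ {ι κ : Type u} {D : ι → ℝ × WithTop ℝ} {D' : κ → ℝ × WithTop ℝ},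
      (Set.range D).Finite → (Set.range D').Finite →
      (∀ A : Set ι, (∀ i ∈ A, ¬ NearDiagonal δ (D i)) →
        #A ≤ #{j | ∃ i ∈ A, WithinDist δ (D i) (D' j)}) →
      ∃ f : {i | ¬ NearDiagonal δ (D i)} → κ, f.Injective ∧
        ∀ i : {i | ¬ NearDiagonal δ (D i)}, WithinDist δ (D i) (D' (f i)) := by
    intro ι κ D D' hD hD' hall
    have := hD.to_subtype
    have := hD'.to_subtype
    refine exists_injective_of_finite_types (S := Set.range D) (T := Set.range D')
      (fun i : {i | ¬ NearDiagonal δ (D i)} => ⟨D i, Set.mem_range_self _⟩) (fun j => ⟨D' j, Set.mem_range_self _⟩)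
      (fun p q => WithinDist δ p q) fun A => ?_
    have h := hall (Subtype.val '' A) (by rintro _ ⟨i, _, rfl⟩; exact i.2)
    rw [mk_image_eq Subtype.val_injective] at h
    refine h.trans_eq ?_
    congr! 3
    simp
  obtain ⟨f, hf, hfE⟩ := aux hD hD' (card_le_card_near hδ Φ Ψ hΦΨ hv hw)
  obtain ⟨g, hg, hgE⟩ := aux hD' hD (card_le_card_near hδ Ψ Φ hΨΦ hw hv)
  obtain ⟨m, hm, hl, hr⟩ := exists_pequiv_covering (fun i j => WithinDist δ (D i) (D' j))
    _ _ f hf hfE g hg fun j => hcomm _ _ (hgE j)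
  exact ⟨m, hm, fun i hi => not_not.1 fun h => hl i h hi, fun j hj => not_not.1 fun h => hr j h hj⟩

end Stability

/-! ### From steps to real parameters -/

section RealParameter

/-- A diagram of the restriction of a module over `ℝ` to the steps `a` gives a barcode of the
module, if the module vanishes before the first step and is constant between the steps. -/
theorem IsPersistenceDiagram.exists_isBarcode {K : Type} [Field K] {F : ℝ ⥤ ModuleCat.{u} K}
    {N : ℕ} (a : Fin N ↪o ℝ)
    (hconst : ∀ (i : Fin N) (t : ℝ) (h : a i ≤ t), (∀ j, a j ≤ t → j ≤ i) →
      Function.Bijective (F.map (homOfLE h)))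
    (hzero : ∀ t, (∀ j, t < a j) → Subsingleton (F.obj t))
    {ι : Type u} {D : ι → Fin N × WithTop (Fin N)}
    (hD : IsPersistenceDiagram (a.monotone.functor ⋙ F) D) :
    ∃ v, IsBarcode F (fun i => toFunctionTime a (D i)) v := by
  classical
  obtain ⟨hlt, (gen : ∀ i, F.obj (a (D i).1)), hdead₀, hbasis₀⟩ := hD
  have hdead : ∀ (t : Fin N) (i : ι) (h : (D i).1 ≤ t), (D i).2 ≤ (t : WithTop (Fin N)) →
      F.map (homOfLE (a.monotone h)) (gen i) = 0 := hdead₀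
  have hbasis : ∀ t : Fin N,
      LinearIndependent K (fun i : {i | (D i).1 ≤ t ∧ (t : WithTop (Fin N)) < (D i).2} =>
        F.map (homOfLE (a.monotone i.2.1)) (gen i)) ∧
      Submodule.span K (Set.range fun i : {i | (D i).1 ≤ t ∧ (t : WithTop (Fin N)) < (D i).2} =>
        F.map (homOfLE (a.monotone i.2.1)) (gen i)) = ⊤ := hbasis₀
  -- For `j` the last step not after `t`, a bar outlives `t` exactly if it outlives step `j`.
  have hd : ∀ (i : ι) (j : Fin N) (t : ℝ), a j ≤ t → (∀ j', a j' ≤ t → j' ≤ j) →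
      ((t : WithTop ℝ) < (D i).2.map a ↔ (j : WithTop (Fin N)) < (D i).2) := by
    intro i j t hjt hj
    induction (D i).2 using WithTop.recTopCoe with
    | top => simp
    | coe d =>
      simp only [WithTop.map_coe, WithTop.coe_lt_coe]
      exact ⟨fun h => a.lt_iff_lt.1 (hjt.trans_lt h),
        fun h => not_le.1 fun h' => (hj d h').not_gt h⟩
  let v : ι → ∀ t, F.obj t := transport F (fun i => a (D i).1) gen
  have hstep : ∀ t, (∀ j, t < a j) ∨ ∃ j, a j ≤ t ∧ ∀ j', a j' ≤ t → j' ≤ j := by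
    intro t
    by_cases h : ∀ j, t < a j
    · exact Or.inl h
    · push Not at h
      obtain ⟨j₀, hj₀⟩ := h
      obtain ⟨j, hj, hmax⟩ := (Finset.univ.filter (a · ≤ t)).exists_max_image id
        ⟨j₀, by simp [hj₀]⟩
      exact Or.inr ⟨j, (Finset.mem_filter.1 hj).2, fun j' hj' => hmax j' (by simp [hj'])⟩
  have hv : ∀ i j t (h : (D i).1 ≤ j) (h' : a j ≤ t),
      v i t = F.map (homOfLE h') (F.map (homOfLE (a.monotone h)) (gen i)) := by
    intro i j t h h'
    rw [map_map_apply]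
    exact transport_of_le F _ gen _
  have halive : ∀ j t, a j ≤ t → (∀ j', a j' ≤ t → j' ≤ j) →
      aliveAt (fun i => toFunctionTime a (D i)) t =
        {i | (D i).1 ≤ j ∧ (j : WithTop (Fin N)) < (D i).2} := by
    intro j t h h'
    ext i
    exact and_congr ⟨h' _, fun hi => (a.monotone hi).trans h⟩ (hd i j t h h')
  have hempty : ∀ t, (∀ j, t < a j) → aliveAt (fun i => toFunctionTime a (D i)) t = ∅ :=
    fun t h => Set.eq_empty_of_forall_notMem fun i hi => (h (D i).1).not_ge hi.1
  refine ⟨v, ?_, fun i s t h h' => map_transport F _ gen h' h, fun i t hi => ?_, fun t => ?_,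
    fun t => ?_⟩
  · intro i
    have := hlt i
    simp only [toFunctionTime]
    rwa [hd i (D i).1 _ le_rfl fun j h => a.le_iff_le.1 h]
  · by_cases h : a (D i).1 ≤ t
    · obtain h' | ⟨j, hj, hmax⟩ := hstep t
      · exact absurd h (h' _).not_ge
      · rw [halive j t hj hmax] at hi
        have hij := hmax _ h
        rw [hv i j t hij hj, hdead j i hij (not_lt.1 fun h => hi ⟨hij, h⟩), map_zero]
    · exact dif_neg h
  · obtain h | ⟨j, hj, hmax⟩ := hstep t
    · rw [hempty t h]
      exact linearIndepOn_empty K _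
    · rw [halive j t hj hmax]
      have h := (hbasis j).1.map' (F.map (homOfLE hj)).hom
        (LinearMap.ker_eq_bot.2 (hconst j t hj hmax).1)
      have e : (fun i : {i | (D i).1 ≤ j ∧ (j : WithTop (Fin N)) < (D i).2} => v i t) = _ :=
        funext fun i => hv i j t i.2.1 hj
      rw [LinearIndepOn, e]
      exact h
  · obtain h | ⟨j, hj, hmax⟩ := hstep t
    · have := hzero t h
      exact fun x _ => (Subsingleton.elim 0 x) ▸ Submodule.zero_mem _
    · rw [halive j t hj hmax]
      have h := congrArg (Submodule.map (F.map (homOfLE hj)).hom) (hbasis j).2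
      rw [Submodule.map_top, LinearMap.range_eq_top.2 (hconst j t hj hmax).2,
        Submodule.map_span, ← Set.range_comp] at h
      rw [← h, Set.image_eq_range]
      refine Submodule.span_mono ?_
      rintro _ ⟨i, rfl⟩
      exact ⟨i, hv i j t i.2.1 hj⟩

end RealParameter

/-! ### Interleaving of forward-backward persistence -/

section Interleaving

variable {X : Type u} [TopologicalSpace X] {C : Set X} [CWComplex C]

/-- The spaces `{f ≤ t} / {g ≤ t - max f}`, for all real `t`. -/
def realSequence (f g : Cells C → ℝ) : ℝ ⥤ TopCat.{u} where
  obj t := TopCat.of (Contracted (sublevel f t) (sublevel g (t - maxVal f)))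
  map {s t} h := TopCat.ofHom <| contractedMap
    (sublevel_mono f (leOfHom h)) (sublevel_mono g (sub_le_sub_right (leOfHom h) _))
  map_id i := by
    ext x
    induction x using Quotient.inductionOn
    rfl
  map_comp a b := by
    ext x
    induction x using Quotient.inductionOn
    rfl

/-- Singular homology `H_k` with coefficients in `ℤ/2`. -/
abbrev homologyZMod2 (k : ℕ) : TopCat.{u} ⥤ ModuleCat.{u} (ZMod 2) :=
  (AlgebraicTopology.singularHomologyFunctor (ModuleCat.{u} (ZMod 2)) k).obj
    (ModuleCat.of (ZMod 2) (ULift.{u} (ZMod 2)))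

/-- The empty space is totally disconnected: its homology is a coproduct over no points in degree
`0` and vanishes in other degrees. This covers parameters before the first function time. -/
theorem subsingleton_homologyZMod2_of_isEmpty (Y : TopCat.{u}) [IsEmpty Y] (k : ℕ) :
    Subsingleton ((homologyZMod2 k).obj Y) := by
  rw [← ModuleCat.isZero_iff_subsingleton]
  rcases eq_or_ne k 0 with rfl | hk
  · refine Limits.IsZero.of_iso ?_
      (AlgebraicTopology.singularHomologyFunctorZeroOfTotallyDisconnectedSpace _ _ Y)
    refine (Limits.IsZero.iff_id_eq_zero _).2 (Limits.Sigma.hom_ext _ _ fun y => isEmptyElim y)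
  · exact AlgebraicTopology.isZero_singularHomologyFunctor_of_totallyDisconnectedSpace _ _ _ Y hk

theorem contractedMap_comp {S S' S'' A A' A'' : Set X} (hS : S ⊆ S') (hA : A ⊆ A')
    (hS' : S' ⊆ S'') (hA' : A' ⊆ A'') :
    TopCat.ofHom (contractedMap hS hA) ≫ TopCat.ofHom (contractedMap hS' hA') =
      TopCat.ofHom (contractedMap (hS.trans hS') (hA.trans hA')) := by
  ext x
  induction x using Quotient.inductionOn
  rfl

theorem contractedMap_refl {S A : Set X} (hS : S ⊆ S) (hA : A ⊆ A) :
    TopCat.ofHom (contractedMap hS hA) = 𝟙 _ := by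
  ext x
  induction x using Quotient.inductionOn
  rfl

theorem isIso_contractedMap {S S' A A' : Set X} (hS : S = S') (hA : A = A') :
    IsIso (TopCat.ofHom (contractedMap hS.subset hA.subset)) :=
  ⟨TopCat.ofHom (contractedMap hS.superset hA.superset),
    by rw [contractedMap_comp, contractedMap_refl],
    by rw [contractedMap_comp, contractedMap_refl]⟩

theorem map_homologyZMod2_apply {S S' S'' A A' A'' : Set X} (hS : S ⊆ S') (hA : A ⊆ A')
    (hS' : S' ⊆ S'') (hA' : A' ⊆ A'') (k : ℕ)
    (x : (homologyZMod2 k).obj (TopCat.of (Contracted S A))) :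
    (homologyZMod2 k).map (TopCat.ofHom (contractedMap hS' hA'))
      ((homologyZMod2 k).map (TopCat.ofHom (contractedMap hS hA)) x) =
      (homologyZMod2 k).map
        (TopCat.ofHom (contractedMap (hS.trans hS') (hA.trans hA'))) x := by
  rw [← ModuleCat.comp_apply, ← Functor.map_comp, contractedMap_comp]

/-- The inclusions of the sublevel complexes of `f` and `g` into those of `f'` and `g'` induce a
shifting morphism of persistence modules. -/
def shiftHom {f g f' g' : Cells C → ℝ} {δ : ℝ} (hf : ∀ σ, f' σ ≤ f σ + δ)
    (hg : ∀ σ, g' σ + maxVal f' ≤ g σ + maxVal f + δ) (k : ℕ) :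
    ShiftHom (realSequence f g ⋙ homologyZMod2 k) (realSequence f' g' ⋙ homologyZMod2 k) δ where
  app s t h := (homologyZMod2 k).map <| TopCat.ofHom <| contractedMap
    (Set.iUnion₂_mono' fun σ hσ => ⟨σ, by linarith [hf σ], subset_rfl⟩)
    -- Contraction starts at the maximum of the first function, so the parameter of `σ` here is `g σ
    -- + max f`; hence the maxima in `hg`.
    (Set.iUnion₂_mono' fun σ hσ => ⟨σ, by linarith [hg σ], subset_rfl⟩)
  map_app _ _ _ _ _ x := map_homologyZMod2_apply _ _ _ _ k x
  app_map _ _ _ _ _ x := map_homologyZMod2_apply _ _ _ _ k x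

theorem supDist_nonneg (f f' : Cells C → ℝ) : 0 ≤ supDist f f' :=
  Real.iSup_nonneg fun _ => abs_nonneg _

variable [Finite (Cells C)]

/-- Both sublevel sets jump only at function times, and the space is empty before the first value of
`f`. Points of `D` come from the finitely many pairs of steps, even if `ι` is infinite. -/
theorem IsFBDiagram.exists_isBarcode {f g : Cells C → ℝ} {k : ℕ} {ι : Type u}
    {D : ι → ℝ × WithTop ℝ} (hD : IsFBDiagram f g k D) :
    (Set.range D).Finite ∧ ∃ v, IsBarcode (realSequence f g ⋙ homologyZMod2 k) D v := by
  obtain ⟨D₀, hD₀, hD⟩ := hD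
  obtain rfl : D = fun i => toFunctionTime (fbTime f g) (D₀ i) := funext hD
  have htime : ∀ t ∈ fbTimes f g, ∃ i, fbTime f g i = t := fun t ht => by
    have : t ∈ Set.range ((fbTimes f g).orderEmbOfFin rfl) := by simpa using ht
    exact this
  have hf : ∀ σ, ∃ i, fbTime f g i = f σ := fun σ => htime _ (by simp [fbTimes])
  have hg : ∀ σ, ∃ i, fbTime f g i = maxVal f + g σ := fun σ => htime _ (by simp [fbTimes])
  refine ⟨(Set.finite_range (toFunctionTime (fbTime f g))).subset ?_, ?_⟩
  · rintro _ ⟨i, rfl⟩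
    exact ⟨D₀ i, rfl⟩
  · refine IsPersistenceDiagram.exists_isBarcode (fbTime f g) (fun i t h hi => ?_) (fun t ht => ?_)
      hD₀
    · have h1 : sublevel f (fbTime f g i) = sublevel f t := by
        refine (sublevel_mono f h).antisymm (Set.iUnion₂_mono' fun σ hσ => ⟨σ, ?_, subset_rfl⟩)
        obtain ⟨j, hj⟩ := hf σ
        exact hj ▸ (fbTime f g).monotone (hi j (hj ▸ hσ))
      have h2 : sublevel g (fbTime f g i - maxVal f) = sublevel g (t - maxVal f) := by
        refine (sublevel_mono g (sub_le_sub_right h _)).antisymm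
          (Set.iUnion₂_mono' fun σ hσ => ⟨σ, ?_, subset_rfl⟩)
        obtain ⟨j, hj⟩ := hg σ
        have := (fbTime f g).monotone (hi j (by linarith))
        linarith
      have : IsIso ((realSequence f g).map (homOfLE h)) := isIso_contractedMap h1 h2
      exact ConcreteCategory.bijective_of_isIso ((homologyZMod2 k).map _)
    · have : IsEmpty ((realSequence f g).obj t) := by
        refine ⟨fun x => ?_⟩
        induction x using Quotient.inductionOn with
        | h x =>
        obtain ⟨σ, hσ, -⟩ := Set.mem_iUnion₂.1 x.2
        obtain ⟨j, hj⟩ := hf σ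
        linarith [ht j]
      exact subsingleton_homologyZMod2_of_isEmpty _ k

theorem abs_sub_le_supDist (f f' : Cells C → ℝ) (σ : Cells C) : |f σ - f' σ| ≤ supDist f f' :=
  le_ciSup (f := fun σ => |f σ - f' σ|) (Set.finite_range _).bddAbove σ

theorem exists_isFBDiagram (f g : Cells C → ℝ) (k : ℕ) :
    ∃ (ι : Type u) (D : ι → ℝ × WithTop ℝ), IsFBDiagram f g k D :=
  let ⟨ι, D, hD⟩ := exists_isPersistenceDiagram (fbModule f g k)
  ⟨ι, _, D, hD, fun _ => rfl⟩

/-- The sublevel sets of `f` need a shift by `‖f - f'‖`, those of `g` by `‖g - g'‖ + |max f - max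
f'|`; the stated `δ` dominates both. -/
theorem bottleneckDist_le (f g f' g' : Cells C → ℝ) (k : ℕ) {ι κ : Type u}
    {D : ι → ℝ × WithTop ℝ} {D' : κ → ℝ × WithTop ℝ} (hD : IsFBDiagram f g k D)
    (hD' : IsFBDiagram f' g' k D') :
    bottleneckDist D D' ≤
      ENNReal.ofReal (2 * supDist f f' + supDist g g' + |maxVal f - maxVal f'|) := by
  set δ := 2 * supDist f f' + supDist g g' + |maxVal f - maxVal f'|
  have hf := supDist_nonneg f f'
  have hg := supDist_nonneg g g'
  have hmax := abs_nonneg (maxVal f - maxVal f')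
  have hδ : 0 ≤ δ := by positivity
  obtain ⟨hfin, v, hv⟩ := hD.exists_isBarcode
  obtain ⟨hfin', w, hw⟩ := hD'.exists_isBarcode
  have h1 : ∀ σ, |f σ - f' σ| ≤ δ := fun σ => (abs_sub_le_supDist f f' σ).trans (by linarith)
  have h2 : ∀ σ, |(g σ + maxVal f) - (g' σ + maxVal f')| ≤ δ := fun σ => by
    have := abs_add_le (g σ - g' σ) (maxVal f - maxVal f')
    have := abs_sub_le_supDist g g' σ
    rw [add_sub_add_comm]
    linarith
  obtain ⟨m, hm⟩ := exists_isMatching hδ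
    (shiftHom (fun σ => by linarith [abs_le.1 (h1 σ)]) (fun σ => by linarith [abs_le.1 (h2 σ)]) k)
    (shiftHom (fun σ => by linarith [abs_le.1 (h1 σ)]) (fun σ => by linarith [abs_le.1 (h2 σ)]) k)
    (fun _ _ _ _ _ x => map_homologyZMod2_apply _ _ _ _ k x)
    (fun _ _ _ _ _ x => map_homologyZMod2_apply _ _ _ _ k x) hv hw hfin hfin'
  exact iInf₂_le δ.toNNReal ⟨m, by rwa [Real.coe_toNNReal δ hδ]⟩

end Interleaving

end FBPersistence

end

/-! ### The stability theorem

The interleaving takes place on the level of spaces, where it is induced by inclusions of the unions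
of cells `{f ≤ t}` and `{g ≤ t - max f}`. The decomposition into bars and algebraic stability
hold for modules of any dimension over finitely many steps. So neither closedness of the
sublevel sets nor positivity enters the proof: they only give the sequence its geometric meaning. -/

theorem mainTheorem2 {X : Type u} [TopologicalSpace X] [T2Space X] (C : Set X)
    [Topology.CWComplex C] [Finite (FBPersistence.Cells C)] (hC : C.Nonempty)
    (f g f' g' : FBPersistence.Cells C → ℝ)
    (hf : FBPersistence.IsFiltration f) (hg : FBPersistence.IsFiltration g)
    (hf' : FBPersistence.IsFiltration f') (hg' : FBPersistence.IsFiltration g')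
    (hf_pos : ∀ σ, 0 < f σ) (hg_pos : ∀ σ, 0 < g σ)
    (hf'_pos : ∀ σ, 0 < f' σ) (hg'_pos : ∀ σ, 0 < g' σ) (k : ℕ) :
    (∃ (ι : Type u) (D : ι → ℝ × WithTop ℝ), FBPersistence.IsFBDiagram f g k D) ∧
    (∃ (κ : Type u) (D' : κ → ℝ × WithTop ℝ), FBPersistence.IsFBDiagram f' g' k D') ∧
    ∀ (ι κ : Type u) (D : ι → ℝ × WithTop ℝ) (D' : κ → ℝ × WithTop ℝ),
      FBPersistence.IsFBDiagram f g k D → FBPersistence.IsFBDiagram f' g' k D' →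
      FBPersistence.bottleneckDist D D' ≤
        ENNReal.ofReal (2 * FBPersistence.supDist f f' + FBPersistence.supDist g g' +
          |FBPersistence.maxVal f - FBPersistence.maxVal f'|) := by
  exact ⟨FBPersistence.exists_isFBDiagram f g k, FBPersistence.exists_isFBDiagram f' g' k,
    fun _ _ _ _ hD hD' => FBPersistence.bottleneckDist_le f g f' g' k hD hD'⟩
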